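/- Let $G$ be a finite $2$-group and let $E$ be a maximal normal elementary abelian subgroup of $G$, that is, a subgroup which is maximal with respect to inclusion among the normal elementary abelian $2$-subgroups of $G$. Let $k=d(E)$ be the minimal number of generators (the rank) of $E$, and let $\mho_1(G)=\langle x^{2}\mid x\in G\rangle$ be the subgroup generated by the squares of all elements of $G$. Then $$|G:\mho_1(G)|\leq 2^{\frac{k(k+5)}{2}}.$$ -/

import Mathlib

/-- A group is an elementary abelian `p`-group if it is commutative and every element `x`
satisfies `x ^ p = 1`. The trivial group is included (rank `0`). -/
def IsElementaryAbelian (p : ℕ) (A : Type*) [Group A] : Prop :=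
  (∀ x y : A, x * y = y * x) ∧ ∀ x : A, x ^ p = 1

/-- `E` is maximal, with respect to inclusion, among the normal elementary abelian
`p`-subgroups of `G`. -/
def IsMaximalNormalElementaryAbelian (p : ℕ) {G : Type*} [Group G] (E : Subgroup G) : Prop :=
  Maximal (fun N : Subgroup G => N.Normal ∧ IsElementaryAbelian p N) E

/-- The subgroup `℧_t(G) = ⟨x ^ (p ^ t) | x ∈ G⟩`. -/
def agemo (p t : ℕ) (G : Type*) [Group G] : Subgroup G :=
  Subgroup.closure (Set.range fun x : G => x ^ p ^ t)

/-! Let `C` be the centralizer of `E` and `|E| = 2 ^ e`, so `e ≤ k`. Since `G / C` is a `2`-group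
embedded in `GL_e(2)`, `|G : C| ≤ 2 ^ (e(e-1)/2)`. It remains to bound `|C|` by `2 ^ (3e) |℧₁(G)|`,
and this is done by counting solutions of `x² = 1` in `C`.

Maximality of `E` prevents this number from being divisible by `2|E|` (`not_two_mul_card_dvd`): the
solutions form cosets of `E`, and an even number of cosets would give a second one fixed by
conjugation, which enlarges `E`. On the other hand, if `|C : Y| > 2 ^ (3m)` for a subgroup `Y`
containing all squares of `C`, then `2 ^ (m+1)` divides the number of solutions. Taking `m = e`
yields the bound.

The divisibility is proved for the sums `∑ ε(x²)`, with `ε` an invariant sign character of a normal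
subgroup `K` of `C`, extended by zero (`two_pow_dvd_signSum`). Take `a` of order two and central
modulo `K`. If `ε(a²) = 1`, either `ε` is the average of two invariant extensions to `K ∪ aK`, or
the sum reduces to the subgroup where `ε([a, x]) = 1`, on which the two extensions are conjugate and
have equal sums. If no such `a` exists, `C / ker ε` has no normal four-group containing the image of
`K`, so its squares generate a subgroup of index at most `8` (`index_le_eight_of_no_klein`); this is
the source of the `3` in `2 ^ (3m)`. -/

/-! ### Subgroups of index two -/

/-- The subgroup `L ∪ xL`, when `x` normalizes `L` and `x²` lies in `L`. -/
def Subgroup.adjoinRoot {Γ : Type*} [Group Γ] (L : Subgroup Γ) (x : Γ)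
    (hx : ∀ l ∈ L, x⁻¹ * l * x ∈ L) (hx2 : x * x ∈ L) : Subgroup Γ where
  carrier := {g | g ∈ L ∨ x⁻¹ * g ∈ L}
  one_mem' := Or.inl L.one_mem
  mul_mem' := by
    rintro g h (hg | hg) (hh | hh)
    · exact Or.inl (L.mul_mem hg hh)
    · right
      have := L.mul_mem (hx g hg) hh
      convert this using 1; group
    · right
      have := L.mul_mem hg hh
      convert this using 1; group
    · left
      have := L.mul_mem (L.mul_mem hx2 (hx _ hg)) hh
      convert this using 1; group
  inv_mem' := by
    rintro g (hg | hg)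
    · exact Or.inl (L.inv_mem hg)
    · right
      have := L.mul_mem (hx _ (L.inv_mem hg)) (L.inv_mem hx2)
      convert this using 1; group

theorem Subgroup.mem_adjoinRoot {Γ : Type*} [Group Γ] {L : Subgroup Γ} {x : Γ}
    {hx : ∀ l ∈ L, x⁻¹ * l * x ∈ L} {hx2 : x * x ∈ L} {g : Γ} :
    g ∈ L.adjoinRoot x hx hx2 ↔ g ∈ L ∨ x⁻¹ * g ∈ L := Iff.rfl

theorem Subgroup.card_le_two_mul {Γ : Type*} [Group Γ] [Finite Γ] (C L : Subgroup Γ) (x : Γ)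
    (h : ∀ g ∈ C, g ∈ L ∨ x⁻¹ * g ∈ L) : Nat.card C ≤ 2 * Nat.card L := by
  classical
  have h1 : (C : Set Γ) ⊆ (L : Set Γ) ∪ (fun g => x * g) '' (L : Set Γ) := by
    intro g hg
    rcases h g hg with h | h
    · exact Or.inl h
    · exact Or.inr ⟨_, h, by simp⟩
  have h2 := Set.ncard_le_ncard h1 (Set.toFinite _)
  have h3 := Set.ncard_union_le (L : Set Γ) ((fun g => x * g) '' (L : Set Γ))
  have h4 := Set.ncard_image_le (f := fun g => x * g) (Set.toFinite (L : Set Γ))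
  have h5 : (C : Set Γ).ncard = Nat.card C := rfl
  have h6 : (L : Set Γ).ncard = Nat.card L := rfl
  omega

theorem Subgroup.card_eq_two_mul {Γ : Type*} [Group Γ] [Finite Γ] (C L : Subgroup Γ) (x : Γ)
    (hx : x ∉ L) (h : ∀ g, g ∈ C ↔ g ∈ L ∨ x⁻¹ * g ∈ L) : Nat.card C = 2 * Nat.card L := by
  classical
  have h1 : (C : Set Γ) = (L : Set Γ) ∪ (fun g => x * g) '' (L : Set Γ) := by
    ext g
    simp only [SetLike.mem_coe, Set.mem_union, Set.mem_image, h]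
    refine or_congr Iff.rfl ⟨fun h => ⟨_, h, by simp⟩, ?_⟩
    rintro ⟨l, hl, rfl⟩
    simpa using hl
  have h5 : (C : Set Γ).ncard = Nat.card C := rfl
  have h6 : (L : Set Γ).ncard = Nat.card L := rfl
  rw [← h5, h1, Set.ncard_union_eq _ (Set.toFinite _) (Set.toFinite _),
    Set.ncard_image_of_injective _ (mul_right_injective x), h6, two_mul]
  rw [Set.disjoint_left]
  rintro g hg ⟨l, hl, rfl⟩
  exact hx ((Subgroup.mul_mem_cancel_right L hl).1 hg)

/-- If `L ≤ C` contains the squares of `C`, it is normalized by `C`. -/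
theorem Subgroup.conj_mem_of_sq_mem {Γ : Type*} [Group Γ] {C L : Subgroup Γ} (hLC : L ≤ C)
    (hsq : ∀ c ∈ C, c * c ∈ L) {x : Γ} (hx : x ∈ C) {l : Γ} (hl : l ∈ L) : x⁻¹ * l * x ∈ L := by
  -- `x⁻¹lx = (x⁻¹l)² l⁻¹ x²`.
  have h1 := hsq _ (C.mul_mem (C.inv_mem hx) (hLC hl))
  have := L.mul_mem (L.mul_mem h1 (L.inv_mem hl)) (hsq x hx)
  convert this using 1; group

/-- An element outside a subgroup containing all squares is avoided by a subgroup of index two. -/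
theorem Subgroup.exists_index_two_avoiding {Γ : Type*} [Group Γ] [Finite Γ] {C Y : Subgroup Γ}
    (hYC : Y ≤ C) (hsq : ∀ c ∈ C, c * c ∈ Y) {a : Γ} (haC : a ∈ C) (haY : a ∉ Y) :
    ∃ L : Subgroup Γ, Y ≤ L ∧ L ≤ C ∧ a ∉ L ∧ ∀ g, g ∈ C ↔ g ∈ L ∨ a⁻¹ * g ∈ L := by
  obtain ⟨L, hYL, hL⟩ := Finite.exists_le_maximal
    (p := fun L : Subgroup Γ => Y ≤ L ∧ L ≤ C ∧ a ∉ L) (a := Y) ⟨le_rfl, hYC, haY⟩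
  refine ⟨L, hYL, hL.prop.2.1, hL.prop.2.2, fun g => ⟨fun hg => ?_, ?_⟩⟩
  -- Otherwise `L ∪ gL` is a larger candidate: `a ∈ gL` would force `g ∈ aL`.
  · by_contra! hcon
    have hsqL : ∀ c ∈ C, c * c ∈ L := fun c hc => hYL (hsq c hc)
    have hn : ∀ l ∈ L, g⁻¹ * l * g ∈ L := fun l hl =>
      Subgroup.conj_mem_of_sq_mem hL.prop.2.1 hsqL hg hl
    have hle : L ≤ L.adjoinRoot g hn (hsqL g hg) := fun l hl => Or.inl hl
    have ha : a ∉ L.adjoinRoot g hn (hsqL g hg) := by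
      rintro (h | h)
      · exact hL.prop.2.2 h
      · apply hcon.2
        have h2 : a⁻¹ * g ∈ L := by simpa using L.inv_mem h
        exact h2
    have hC : L.adjoinRoot g hn (hsqL g hg) ≤ C := by
      rintro y (h | h)
      · exact hL.prop.2.1 h
      · simpa using C.mul_mem hg (hL.prop.2.1 h)
    have := hL.le_of_ge ⟨hYL.trans hle, hC, ha⟩ hle
    exact hcon.1 (this (Or.inr (by simp)))
  · rintro (h | h)
    · exact hL.prop.2.1 h
    · simpa using C.mul_mem haC (hL.prop.2.1 h)

/-! ### Invariant sign characters -/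

/-- `ε` is a `C`-invariant homomorphism `K → {±1}` on a subgroup `K` normal in `C`,
extended by zero outside `K`. -/
structure IsInvariantSign {Γ : Type*} [Group Γ] (ε : Γ → ℤ) (C K : Subgroup Γ) : Prop where
  le : K ≤ C
  normal : ∀ c ∈ C, ∀ k ∈ K, c⁻¹ * k * c ∈ K
  zero : ∀ x, x ∉ K → ε x = 0
  one_or : ∀ x ∈ K, ε x = 1 ∨ ε x = -1
  mul : ∀ x ∈ K, ∀ y ∈ K, ε (x * y) = ε x * ε y
  conj : ∀ c ∈ C, ∀ k ∈ K, ε (c⁻¹ * k * c) = ε k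

namespace IsInvariantSign

variable {Γ : Type*} [Group Γ] {ε : Γ → ℤ} {C K : Subgroup Γ}

theorem mul_right (h : IsInvariantSign ε C K) (x : Γ) {k : Γ} (hk : k ∈ K) :
    ε (x * k) = ε x * ε k := by
  by_cases hx : x ∈ K
  · exact h.mul x hx k hk
  · rw [h.zero x hx, h.zero _ (mt (K.mul_mem_cancel_right hk).1 hx), zero_mul]

theorem mul_left (h : IsInvariantSign ε C K) (x : Γ) {k : Γ} (hk : k ∈ K) :
    ε (k * x) = ε k * ε x := by
  by_cases hx : x ∈ K
  · exact h.mul k hk x hx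
  · rw [h.zero x hx, h.zero _ (mt (K.mul_mem_cancel_left hk).1 hx), mul_zero]

theorem conj_mem_iff (h : IsInvariantSign ε C K) {c : Γ} (hc : c ∈ C) (x : Γ) :
    c⁻¹ * x * c ∈ K ↔ x ∈ K := by
  refine ⟨fun hx => ?_, h.normal c hc x⟩
  have := h.normal _ (C.inv_mem hc) _ hx
  convert this using 1; group

theorem conj' (h : IsInvariantSign ε C K) {c : Γ} (hc : c ∈ C) (x : Γ) :
    ε (c⁻¹ * x * c) = ε x := by
  by_cases hx : x ∈ K
  · exact h.conj c hc x hx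
  · rw [h.zero x hx, h.zero _ (mt (h.conj_mem_iff hc x).1 hx)]

theorem sq_eq_one (h : IsInvariantSign ε C K) {k : Γ} (hk : k ∈ K) : ε k * ε k = 1 := by
  rcases h.one_or k hk with h | h <;> simp [h]

theorem map_one (h : IsInvariantSign ε C K) : ε 1 = 1 := by
  have := h.mul 1 K.one_mem 1 K.one_mem
  rw [mul_one] at this
  rw [this, h.sq_eq_one K.one_mem]

theorem mono (h : IsInvariantSign ε C K) {H : Subgroup Γ} (hH : H ≤ C) (hK : K ≤ H) :
    IsInvariantSign ε H K :=
  ⟨hK, fun c hc => h.normal c (hH hc), h.zero, h.one_or, h.mul, fun c hc => h.conj c (hH hc)⟩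

/-- `(xk)² = x² · (x⁻¹kx) · k`, and by invariance the last two factors have equal signs, which
cancel. -/
theorem mul_self_mul_of_mem (h : IsInvariantSign ε C K) {x k : Γ} (hx : x ∈ C) (hk : k ∈ K) :
    ε ((x * k) * (x * k)) = ε (x * x) := by
  have e : (x * k) * (x * k) = (x * x) * ((x⁻¹ * k * x) * k) := by group
  rw [e, h.mul_right _ (K.mul_mem (h.normal x hx k hk) hk), h.mul _ (h.normal x hx k hk) k hk,
    h.conj x hx k hk, h.sq_eq_one hk, mul_one]

/-- `x ↦ ε([a, x])`. -/
theorem comm_mul (h : IsInvariantSign ε C K) {a x y : Γ} (hy : y ∈ C)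
    (hay : a⁻¹ * y⁻¹ * a * y ∈ K) :
    ε (a⁻¹ * (x * y)⁻¹ * a * (x * y)) = ε (a⁻¹ * x⁻¹ * a * x) * ε (a⁻¹ * y⁻¹ * a * y) := by
  have e : a⁻¹ * (x * y)⁻¹ * a * (x * y)
      = (a⁻¹ * y⁻¹ * a * y) * (y⁻¹ * (a⁻¹ * x⁻¹ * a * x) * y) := by group
  rw [e, h.mul_left _ hay, h.conj' hy, mul_comm]

theorem mul_self_mul (h : IsInvariantSign ε C K) {a x : Γ} (ha : a ∈ C) (ha2 : a * a ∈ K)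
    (hax : a⁻¹ * x⁻¹ * a * x ∈ K) :
    ε ((x * a) * (x * a)) = ε (x * x) * ε (a⁻¹ * x⁻¹ * a * x) * ε (a * a) := by
  have e : (x * a) * (x * a)
      = (x * x) * ((a⁻¹⁻¹ * (a⁻¹ * x⁻¹ * a * x) * a⁻¹) * (a * a)) := by group
  have h1 := h.normal _ (C.inv_mem ha) _ hax
  rw [e, h.mul_right _ (K.mul_mem h1 ha2), h.mul _ h1 _ ha2, h.conj' (C.inv_mem ha)]; ring

/-- The two extensions of `ε` to `K ∪ aK`. -/
theorem extend (h : IsInvariantSign ε C K) {a : Γ} (ha : a ∈ C) (haK : a ∉ K) (ha2 : a * a ∈ K)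
    (hε : ε (a * a) = 1) {H : Subgroup Γ} (hHC : H ≤ C) (hKH : K ≤ H) (haH : a ∈ H)
    (hcK : ∀ x ∈ H, a⁻¹ * x⁻¹ * a * x ∈ K) (hc : ∀ x ∈ H, ε (a⁻¹ * x⁻¹ * a * x) = 1)
    {δ : ℤ} (hδ : δ = 1 ∨ δ = -1) :
    IsInvariantSign (fun y => ε y + δ * ε (a⁻¹ * y)) H
      (K.adjoinRoot a (h.normal a ha) ha2) := by
  have hδ2 : δ * δ = 1 := by rcases hδ with rfl | rfl <;> norm_num
  -- `K` and `aK` are disjoint, so at most one of the two summands is nonzero.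
  have hin : ∀ y, y ∈ K → ε (a⁻¹ * y) = 0 := fun y hy => h.zero _ fun h' => haK (by
    have := K.mul_mem hy (K.inv_mem h'); simpa using this)
  have hout : ∀ y, a⁻¹ * y ∈ K → ε y = 0 := fun y hy => h.zero _ fun h' => haK (by
    have := K.mul_mem h' (K.inv_mem hy); simpa using this)
  -- Conjugation by `c` changes the sign on `aK` by `ε([a, c])`, which is `1` on `H`.
  have hconj : ∀ c ∈ H, ∀ y, ε (a⁻¹ * (c⁻¹ * y * c)) = ε (a⁻¹ * y) := by
    intro c hc' y
    have e : a⁻¹ * (c⁻¹ * y * c) = (a⁻¹ * c⁻¹ * a * c) * (c⁻¹ * (a⁻¹ * y) * c) := by group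
    rw [e, h.mul_left _ (hcK c hc'), hc c hc', one_mul, h.conj' (hHC hc')]
  refine ⟨?_, ?_, ?_, ?_, ?_, ?_⟩
  · rintro y (hy | hy)
    · exact hKH hy
    · simpa using H.mul_mem haH (hKH hy)
  · rintro c hc' k (hk | hk)
    · exact Or.inl (h.normal c (hHC hc') k hk)
    · right
      have e : a⁻¹ * (c⁻¹ * k * c) = (a⁻¹ * c⁻¹ * a * c) * (c⁻¹ * (a⁻¹ * k) * c) := by group
      rw [e]
      exact K.mul_mem (hcK c hc') (h.normal c (hHC hc') _ hk)
  · intro x hx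
    rw [Subgroup.mem_adjoinRoot, not_or] at hx
    simp [h.zero _ hx.1, h.zero _ hx.2]
  · rintro x (hx | hx)
    · simpa [hin x hx] using h.one_or x hx
    · have := h.one_or _ hx
      simp only [hout x hx, zero_add]
      rcases hδ with rfl | rfl <;> rcases this with h | h <;> simp [h]
  · rintro x (hx | hx) y (hy | hy)
    · simp [hin x hx, hin y hy, hin _ (K.mul_mem hx hy), h.mul x hx y hy]
    · have e : a⁻¹ * (x * y) = (a⁻¹ * x * a) * (a⁻¹ * y) := by group
      have h1 := h.normal a ha x hx
      have h2 : a⁻¹ * (x * y) ∈ K := by rw [e]; exact K.mul_mem h1 hy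
      simp only [hin x hx, hout y hy, hout _ h2]
      rw [e, h.mul _ h1 _ hy, h.conj a ha x hx]; ring
    · have e : a⁻¹ * (x * y) = (a⁻¹ * x) * y := by group
      have h2 : a⁻¹ * (x * y) ∈ K := by rw [e]; exact K.mul_mem hx hy
      simp only [hin y hy, hout x hx, hout _ h2]
      rw [e, h.mul _ hx _ hy]; ring
    -- The case `aK · aK ⊆ K` is where `ε(a²) = 1` is needed.
    · have e : x * y = (a * a) * (a⁻¹ * (a⁻¹ * x) * a) * (a⁻¹ * y) := by group
      have h1 := h.normal a ha _ hx
      have h2 : x * y ∈ K := by rw [e]; exact K.mul_mem (K.mul_mem ha2 h1) hy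
      simp only [hin _ h2, hout x hx, hout y hy]
      rw [e, h.mul _ (K.mul_mem ha2 h1) _ hy, h.mul _ ha2 _ h1, hε, h.conj' ha]
      linear_combination (-(ε (a⁻¹ * x) * ε (a⁻¹ * y))) * hδ2
  · intro c hc' k hk
    simp only [hconj c hc', h.conj' (hHC hc')]

end IsInvariantSign

/-! ### Sums of signs of squares -/

open Classical in
/-- `∑_{x ∈ C} ε(x²)`. -/
noncomputable def signSum {Γ : Type*} [Group Γ] [Fintype Γ] (C : Subgroup Γ) (ε : Γ → ℤ) : ℤ :=
  ∑ x : Γ, if x ∈ C then ε (x * x) else 0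

section Sums

variable {Γ : Type*} [Group Γ] [Fintype Γ]

theorem sum_eq_zero_of_mul_right_eq_neg (d : Γ → ℤ) (a : Γ) (h : ∀ x, d (x * a) = -d x) :
    ∑ x, d x = 0 := by
  have h1 := Equiv.sum_comp (Equiv.mulRight a) d
  simp only [Equiv.coe_mulRight, h, Finset.sum_neg_distrib] at h1
  omega

theorem signSum_add (C : Subgroup Γ) (ε₁ ε₂ : Γ → ℤ) :
    signSum C ε₁ + signSum C ε₂ = signSum C (fun x => ε₁ x + ε₂ x) := by
  simp only [signSum, ← Finset.sum_add_distrib]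
  refine Finset.sum_congr rfl fun x _ => ?_
  split_ifs <;> simp

theorem signSum_two_mul (C : Subgroup Γ) (ε : Γ → ℤ) :
    signSum C (fun x => 2 * ε x) = 2 * signSum C ε := by
  simp only [signSum, Finset.mul_sum]
  refine Finset.sum_congr rfl fun x _ => ?_
  split_ifs <;> simp

theorem signSum_extend (C : Subgroup Γ) (ε : Γ → ℤ) (a : Γ) :
    signSum C (fun y => ε y + 1 * ε (a⁻¹ * y)) + signSum C (fun y => ε y + (-1) * ε (a⁻¹ * y))
      = 2 * signSum C ε := by
  rw [signSum_add, ← signSum_two_mul]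
  congr 1
  funext x
  ring

theorem signSum_conj (C : Subgroup Γ) (ε : Γ → ℤ) (g : Γ) (hg : ∀ x, g⁻¹ * x * g ∈ C ↔ x ∈ C) :
    signSum C (fun y => ε (g⁻¹ * y * g)) = signSum C ε := by
  have h := Equiv.sum_comp (MulAut.conj g⁻¹).toEquiv
    (fun x => open Classical in if x ∈ C then ε (x * x) else 0)
  rw [signSum, signSum, ← h]
  refine Finset.sum_congr rfl fun x _ => ?_
  have e1 : (MulAut.conj g⁻¹).toEquiv x = g⁻¹ * x * g := by simp
  have e2 : g⁻¹ * x * g * (g⁻¹ * x * g) = g⁻¹ * (x * x) * g := by group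
  have e3 : (MulAut.conj g⁻¹).toEquiv x ∈ C ↔ x ∈ C := by rw [e1, hg]
  by_cases hx : x ∈ C
  · rw [if_pos hx, if_pos (e3.2 hx), e1, e2]
  · rw [if_neg hx, if_neg (mt e3.1 hx)]

/-- Right multiplication by `a` preserves `C \ H` and negates the terms there, so they sum to zero.
-/
theorem signSum_eq_of_neg (C H : Subgroup Γ) (hHC : H ≤ C) (ε : Γ → ℤ) (a : Γ) (ha : a ∈ H)
    (h : ∀ x ∈ C, x ∉ H → ε ((x * a) * (x * a)) = -ε (x * x)) :
    signSum C ε = signSum H ε := by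
  classical
  rw [← sub_eq_zero, signSum, signSum, ← Finset.sum_sub_distrib]
  refine sum_eq_zero_of_mul_right_eq_neg _ a fun x => ?_
  simp only [C.mul_mem_cancel_right (hHC ha), H.mul_mem_cancel_right ha]
  by_cases hxC : x ∈ C <;> by_cases hxH : x ∈ H
  · simp [hxC, hxH]
  · simp [hxC, hxH, h x hxC hxH]
  · exact absurd (hHC hxH) hxC
  · simp [hxC, hxH]

/-- Right multiplication by `a` carries `L` onto `La = aL`, the other half of `C`, without changing
the terms. -/
theorem signSum_eq_two_mul (C L : Subgroup Γ) (ε : Γ → ℤ) (a : Γ) (haL : a ∉ L)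
    (hC : ∀ g, g ∈ C ↔ g ∈ L ∨ a⁻¹ * g ∈ L) (haC : ∀ g, a⁻¹ * g * a ∈ L ↔ g ∈ L)
    (h : ∀ x ∈ L, ε ((x * a) * (x * a)) = ε (x * x)) :
    signSum C ε = 2 * signSum L ε := by
  classical
  have h1 := Equiv.sum_comp (Equiv.mulRight a)
    (fun x => if a⁻¹ * x ∈ L then ε (x * x) else 0)
  have h2 : ∑ x : Γ, (if a⁻¹ * x ∈ L then ε (x * x) else 0) = signSum L ε := by
    rw [← h1, signSum]
    refine Finset.sum_congr rfl fun x _ => ?_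
    simp only [Equiv.coe_mulRight, ← mul_assoc a⁻¹ x a, haC]
    split_ifs with hx
    · exact h x hx
    · rfl
  rw [two_mul]
  nth_rw 2 [← h2]
  rw [signSum, signSum, ← Finset.sum_add_distrib]
  refine Finset.sum_congr rfl fun x _ => ?_
  rw [hC]
  by_cases h3 : x ∈ L <;> by_cases h4 : a⁻¹ * x ∈ L
  · exact absurd (by simpa using L.mul_mem h3 (L.inv_mem h4)) haL
  all_goals simp [h3, h4]

theorem dvd_sum_of_dvd_sum_coset (A : Subgroup Γ) [Fintype A] (g : Γ → ℤ) (n : ℤ)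
    (h : ∀ x, n ∣ ∑ y : A, g (x * y)) : n ∣ ∑ x, g x := by
  classical
  have hb : Function.Bijective fun p : (Γ ⧸ A) × A => p.1.out * (p.2 : Γ) := by
    constructor
    · rintro ⟨q, y⟩ ⟨r, w⟩ h
      have h' : q.out * (y : Γ) = r.out * (w : Γ) := h
      have hq := congrArg (QuotientGroup.mk : Γ → Γ ⧸ A) h'
      rw [QuotientGroup.mk_mul_of_mem _ y.2, QuotientGroup.mk_mul_of_mem _ w.2,
        QuotientGroup.out_eq', QuotientGroup.out_eq'] at hq
      subst hq
      exact Prod.ext rfl (Subtype.ext (mul_left_cancel h'))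
    · intro x
      refine ⟨(x, ⟨(x : Γ ⧸ A).out⁻¹ * x, QuotientGroup.eq.1 (QuotientGroup.out_eq' _)⟩), ?_⟩
      simp
  rw [← (Equiv.ofBijective _ hb).sum_comp, Fintype.sum_prod_type]
  exact Finset.dvd_sum fun q _ => h q.out

end Sums

namespace IsInvariantSign

variable {Γ : Type*} [Group Γ] {ε : Γ → ℤ} {C K : Subgroup Γ}

theorem two_mul_card_dvd [Fintype Γ] (h : IsInvariantSign ε C K) {a : Γ} (ha : a ∈ C)
    (haK : a ∉ K) (ha2 : a * a ∈ K) (hcK : ∀ x ∈ C, a⁻¹ * x⁻¹ * a * x ∈ K) :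
    (2 * Nat.card K : ℤ) ∣ signSum C ε := by
  classical
  refine dvd_sum_of_dvd_sum_coset (K.adjoinRoot a (h.normal a ha) ha2) _ _ fun x => ?_
  have hAC : ∀ y ∈ K.adjoinRoot a (h.normal a ha) ha2, y ∈ C := by
    rintro y (hy | hy)
    · exact h.le hy
    · simpa using C.mul_mem ha (h.le hy)
  by_cases hx : x ∈ C
  swap
  · rw [Finset.sum_eq_zero]
    · exact dvd_zero _
    · rintro ⟨y, hy⟩ _
      rw [if_neg (mt (C.mul_mem_cancel_right (hAC y hy)).1 hx)]
  set A := K.adjoinRoot a (h.normal a ha) ha2 with hA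
  -- The sign is constant on `xK` and on `xaK`, so the sum over `xA` is `ε(x²) |K| (1 ± 1)`.
  have hval : ∀ y : A, (if x * (y : Γ) ∈ C then ε ((x * y) * (x * y)) else 0)
      = ε (x * x) * (if (y : Γ) ∈ K then 1 else ε (a⁻¹ * x⁻¹ * a * x) * ε (a * a)) := by
    rintro ⟨y, hy⟩
    rw [if_pos (C.mul_mem hx (hAC y hy))]
    by_cases hyK : y ∈ K
    · rw [if_pos hyK, h.mul_self_mul_of_mem hx hyK, mul_one]
    · rw [if_neg hyK]
      have hy' : a⁻¹ * y ∈ K := hy.resolve_left hyK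
      obtain ⟨k, rfl⟩ : ∃ k, y = a * k := ⟨a⁻¹ * y, by simp⟩
      rw [inv_mul_cancel_left] at hy'
      simp only
      rw [show x * (a * k) = x * a * k from (mul_assoc x a k).symm,
        h.mul_self_mul_of_mem (C.mul_mem hx ha) hy', h.mul_self_mul ha ha2 (hcK x hx), mul_assoc]
  simp only [hval, ← Finset.mul_sum]
  refine Dvd.dvd.mul_left ?_ _
  have hKA : K ≤ A := fun k hk => Or.inl hk
  have hc1 : (Finset.univ.filter fun y : A => (y : Γ) ∈ K).card = Nat.card K := by
    rw [← Fintype.card_subtype, ← Nat.card_eq_fintype_card]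
    exact Nat.card_congr (Subgroup.subgroupOfEquivOfLe hKA).toEquiv
  have hc2 : Nat.card A = 2 * Nat.card K :=
    Subgroup.card_eq_two_mul A K a haK fun g => Iff.rfl
  have hc3 : (Finset.univ.filter fun y : A => ¬ (y : Γ) ∈ K).card = Nat.card K := by
    have := Finset.card_filter_add_card_filter_not (s := (Finset.univ : Finset A))
      (fun y : A => (y : Γ) ∈ K)
    rw [hc1, Finset.card_univ, ← Nat.card_eq_fintype_card, hc2] at this
    omega
  rw [Finset.sum_ite, Finset.sum_const, Finset.sum_const, hc1, hc3]
  rcases h.one_or _ (hcK x hx) with h1 | h1 <;> rcases h.one_or _ ha2 with h2 | h2 <;>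
    rw [h1, h2]
  · exact ⟨1, by simp; ring⟩
  · exact ⟨0, by simp⟩
  · exact ⟨0, by simp⟩
  · exact ⟨1, by simp; ring⟩

end IsInvariantSign

/-! ### Fixed points in `2`-groups -/

/-- In a finite `2`-group, an invariant set made of evenly many cosets of a normal subgroup `E`,
among them `E` itself, contains another coset that is central modulo `E`. -/
theorem IsPGroup.exists_central_mod {G : Type*} [Group G] [Finite G] (hG : IsPGroup 2 G)
    (E : Subgroup G) [E.Normal] (T : Set G) (hT1 : (1 : G) ∈ T)
    (hTE : ∀ x ∈ T, ∀ e ∈ E, x * e ∈ T) (hTc : ∀ x ∈ T, ∀ g : G, g * x * g⁻¹ ∈ T)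
    (heven : 2 * Nat.card E ∣ Nat.card T) :
    ∃ x ∈ T, x ∉ E ∧ ∀ g : G, x⁻¹ * g⁻¹ * x * g ∈ E := by
  let T' : Set (G ⧸ E) := (QuotientGroup.mk' E) '' T
  have hpre : (QuotientGroup.mk ⁻¹' T' : Set G) = T := by
    ext x
    constructor
    · rintro ⟨y, hy, hyx⟩
      have : y⁻¹ * x ∈ E := QuotientGroup.eq.1 hyx
      simpa using hTE y hy _ this
    · exact fun hx => ⟨x, hx, rfl⟩
  have hcard : Nat.card T = Nat.card E * Nat.card T' := by
    rw [← Nat.card_prod, ← Nat.card_congr (QuotientGroup.preimageMkEquivSubgroupProdSet E T'), hpre]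
  have h2 : 2 ∣ Nat.card T' := by
    rw [hcard, mul_comm 2] at heven
    exact Nat.dvd_of_mul_dvd_mul_left Nat.card_pos heven
  let : MulAction G T' :=
    { smul := fun g t => ⟨(g : G ⧸ E) * t.1 * (g : G ⧸ E)⁻¹, by
        obtain ⟨t, x, hx, rfl⟩ := t
        exact ⟨g * x * g⁻¹, hTc x hx g, rfl⟩⟩
      one_smul := fun t => Subtype.ext (by
        change ((1 : G) : G ⧸ E) * t.1 * ((1 : G) : G ⧸ E)⁻¹ = t.1
        simp)
      mul_smul := fun g h t => Subtype.ext (by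
        change ((g * h : G) : G ⧸ E) * t.1 * ((g * h : G) : G ⧸ E)⁻¹
          = (g : G ⧸ E) * ((h : G ⧸ E) * t.1 * (h : G ⧸ E)⁻¹) * (g : G ⧸ E)⁻¹
        rw [QuotientGroup.mk_mul]
        group) }
  have hsmul : ∀ (g : G) (t : T'), ((g • t : T') : G ⧸ E) = (g : G ⧸ E) * t.1 * (g : G ⧸ E)⁻¹ :=
    fun _ _ => rfl
  have hone : (⟨1, 1, hT1, rfl⟩ : T') ∈ MulAction.fixedPoints G T' := fun g =>
    Subtype.ext (by rw [hsmul]; simp)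
  -- The number of cosets fixed by conjugation is even, and `E` is one of them.
  obtain ⟨⟨q, x, hx, hxq⟩, hfix, hne⟩ :=
    hG.exists_fixed_point_of_prime_dvd_card_of_fixed_point T' h2 hone
  have hxq' : (x : G ⧸ E) = q := hxq
  refine ⟨x, hx, fun hxE => hne (Subtype.ext ?_), fun g => ?_⟩
  · change 1 = q
    rw [← hxq', (QuotientGroup.eq_one_iff x).2 hxE]
  · have h3 := congrArg Subtype.val (hfix g)
    rw [hsmul] at h3
    simp only [← hxq'] at h3
    rw [← QuotientGroup.eq_one_iff]
    simp only [QuotientGroup.mk_mul, QuotientGroup.mk_inv]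
    rw [mul_inv_eq_iff_eq_mul] at h3
    rw [mul_assoc, ← h3]
    group

theorem IsPGroup.exists_central_order_two {G : Type*} [Group G] [Finite G] [Nontrivial G]
    (hG : IsPGroup 2 G) : ∃ a : G, a ≠ 1 ∧ a * a = 1 ∧ ∀ x, a * x = x * a := by
  have := hG.center_nontrivial
  obtain ⟨n, hn, hc⟩ := (hG.to_subgroup (Subgroup.center G)).nontrivial_iff_card.1 this
  obtain ⟨a, ha⟩ := exists_prime_orderOf_dvd_card' (G := Subgroup.center G) 2
    (hc ▸ dvd_pow_self 2 hn.ne')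
  refine ⟨a, ?_, ?_, fun x => (Subgroup.mem_center_iff.1 a.2 x).symm⟩
  · intro h
    have : a = 1 := Subtype.ext h
    rw [this, orderOf_one] at ha
    omega
  · have := pow_orderOf_eq_one a
    rw [ha, pow_two] at this
    exact congrArg Subtype.val this

/-- A proper normal subgroup of a finite `2`-group has index two in a larger one,
central modulo the first. -/
theorem IsPGroup.exists_central_order_two_mod {Γ : Type*} [Group Γ] [Finite Γ]
    (hΓ : IsPGroup 2 Γ) {C K : Subgroup Γ}
    (hn : ∀ c ∈ C, ∀ k ∈ K, c⁻¹ * k * c ∈ K) (hlt : Nat.card K < Nat.card C) :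
    ∃ a ∈ C, a ∉ K ∧ a * a ∈ K ∧ ∀ x ∈ C, a⁻¹ * x⁻¹ * a * x ∈ K := by
  have hN : (K.subgroupOf C).Normal := ⟨fun n hn' g => by
    have := hn g⁻¹ (C.inv_mem g.2) n hn'
    simpa [Subgroup.mem_subgroupOf] using this⟩
  have : Nontrivial (C ⧸ K.subgroupOf C) := by
    rw [QuotientGroup.nontrivial_iff, Ne, Subgroup.subgroupOf_eq_top]
    intro hle
    have := Nat.card_mono (Set.toFinite _) hle
    simp only [SetLike.coe_sort_coe] at this
    omega
  obtain ⟨q, hq1, hq2, hqc⟩ := ((hΓ.to_subgroup C).to_quotient (K.subgroupOf C)).exists_central_order_two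
  obtain ⟨a, rfl⟩ := QuotientGroup.mk_surjective q
  refine ⟨a, a.2, fun h => hq1 ((QuotientGroup.eq_one_iff a).2 h), ?_, fun x hx => ?_⟩
  · rw [← QuotientGroup.mk_mul] at hq2
    exact (QuotientGroup.eq_one_iff (a * a)).1 hq2
  · have h1 := hqc (⟨x, hx⟩ : C)
    rw [← QuotientGroup.mk_mul, ← QuotientGroup.mk_mul, eq_comm, QuotientGroup.eq] at h1
    have h2 := Subgroup.mem_subgroupOf.1 h1
    convert h2 using 1
    simp [mul_assoc]

/-! ### Abelian `2`-groups and units modulo `2 ^ n` -/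

theorem card_sq_eq_one_mul_card_range {A : Type*} [CommGroup A] [Finite A] :
    Nat.card A = Nat.card {a : A // a ^ 2 = 1} * Nat.card (powMonoidHom 2 : A →* A).range := by
  have h := Subgroup.card_mul_index (powMonoidHom 2 : A →* A).ker
  rw [Subgroup.index_ker] at h
  rw [← h]
  rfl

/-- Squaring maps the `2 ^ (n+1)`-torsion into the `2 ^ n`-torsion with kernel of order at most two.
-/
theorem card_pow_two_pow_eq_one_le {A : Type*} [CommGroup A] [Finite A]
    (h : Nat.card {a : A // a ^ 2 = 1} ≤ 2) (n : ℕ) : Nat.card {a : A // a ^ 2 ^ n = 1} ≤ 2 ^ n := by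
  induction n with
  | zero => simp
  | succ n ih =>
    have h1 := card_sq_eq_one_mul_card_range (A := (powMonoidHom (2 ^ (n + 1)) : A →* A).ker)
    set S := (powMonoidHom (2 ^ (n + 1)) : A →* A).ker with hS
    have h2 : Nat.card {a : S // a ^ 2 = 1} ≤ 2 := by
      refine le_trans (Nat.card_le_card_of_injective
        (fun a => (⟨a.1.1, by have := congrArg Subtype.val a.2; simpa using this⟩ :
          {a : A // a ^ 2 = 1})) ?_) h
      intro a b hab
      exact Subtype.ext (Subtype.ext (Subtype.mk.inj hab))
    have h3 : Nat.card (powMonoidHom 2 : S →* S).range ≤ 2 ^ n := by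
      refine le_trans (Nat.card_le_card_of_injective
        (fun a => (⟨a.1.1, ?_⟩ : {a : A // a ^ 2 ^ n = 1})) ?_) ih
      · obtain ⟨b, hb⟩ := a.2
        have hb' : (b : A) ^ 2 ^ (n + 1) = 1 := b.2
        rw [← hb]
        change ((b : A) ^ 2) ^ 2 ^ n = 1
        rw [← pow_mul, ← pow_succ']
        exact hb'
      · intro a b hab
        exact Subtype.ext (Subtype.ext (Subtype.mk.inj hab))
    have h4 : Nat.card {a : A // a ^ 2 ^ (n + 1) = 1} = Nat.card S := rfl
    rw [h4, h1, pow_succ']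
    exact Nat.mul_le_mul h2 h3

/-- An abelian `2`-group with at most one involution is cyclic. -/
theorem IsPGroup.isCyclic_of_card_sq_eq_one_le {A : Type*} [CommGroup A] [Finite A]
    (hA : IsPGroup 2 A) (h : Nat.card {a : A // a ^ 2 = 1} ≤ 2) : IsCyclic A := by
  classical
  have := Fintype.ofFinite A
  refine isCyclic_of_card_pow_eq_one_le fun n hn => ?_
  obtain ⟨k, m, hm, rfl⟩ := Nat.exists_eq_two_pow_mul_odd hn.ne'
  refine le_trans ?_ ((card_pow_two_pow_eq_one_le h k).trans (Nat.le_mul_of_pos_right _ hm.pos))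
  rw [Nat.card_eq_fintype_card, Fintype.card_subtype]
  refine Finset.card_le_card fun a ha => ?_
  simp only [Finset.mem_filter, Finset.mem_univ, true_and] at ha ⊢
  obtain ⟨j, hj⟩ := hA (a ^ 2 ^ k)
  have h1 : (a ^ 2 ^ k) ^ m = 1 := by rw [← pow_mul]; exact ha
  have h2 := Nat.dvd_gcd (orderOf_dvd_of_pow_eq_one h1) (orderOf_dvd_of_pow_eq_one hj)
  rw [(hm.coprime_two_right.pow_right j).gcd_eq_one] at h2
  exact orderOf_eq_one_iff.1 (Nat.dvd_one.1 h2)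

theorem ZMod.card_units_two_pow_sq_eq_one_le (n : ℕ) :
    Nat.card {u : (ZMod (2 ^ n))ˣ // u ^ 2 = 1} ≤ 4 := by
  classical
  have key : ∀ u : (ZMod (2 ^ n))ˣ, u ^ 2 = 1 → (u : ZMod (2 ^ n)) ∈
      ({1, -1, 1 + 2 ^ (n - 1), -1 + 2 ^ (n - 1)} : Finset (ZMod (2 ^ n))) := by
    intro u hu
    rcases n with _ | n
    · have : Subsingleton (ZMod (2 ^ 0)) := by rw [pow_zero]; infer_instance
      simp [Subsingleton.elim (u : ZMod (2 ^ 0)) 1]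
    obtain ⟨v, hv⟩ := ZMod.intCast_surjective (u : ZMod (2 ^ (n + 1)))
    have h1 : ((v ^ 2 - 1 : ℤ) : ZMod (2 ^ (n + 1))) = 0 := by
      push_cast
      rw [hv, ← Units.val_pow_eq_pow_val, hu]; simp
    rw [ZMod.intCast_zmod_eq_zero_iff_dvd] at h1
    push_cast at h1
    have hodd : Odd v := by
      have : (2 : ℤ) ∣ v ^ 2 - 1 := (dvd_pow_self 2 n.succ_ne_zero).trans h1
      by_contra hv'
      rw [Int.not_odd_iff_even] at hv'
      obtain ⟨w, rfl⟩ := hv'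
      obtain ⟨c, hc⟩ := this
      ring_nf at hc
      omega
    have hlift : ∀ s : ℤ, (2 : ℤ) ^ n ∣ v - s → (v : ZMod (2 ^ (n + 1))) = s ∨
        (v : ZMod (2 ^ (n + 1))) = s + 2 ^ n := by
      rintro s ⟨c, hc⟩
      rcases Int.even_or_odd' c with ⟨d, rfl | rfl⟩
      · left
        rw [ZMod.intCast_eq_intCast_iff_dvd_sub]
        refine ⟨-d, ?_⟩
        push_cast
        rw [pow_succ]; linear_combination -hc
      · right
        have : ((2 : ZMod (2 ^ (n + 1))) ^ n) = (((2 : ℤ) ^ n : ℤ) : ZMod (2 ^ (n + 1))) := by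
          push_cast; rfl
        rw [this, ← Int.cast_add, ZMod.intCast_eq_intCast_iff_dvd_sub]
        refine ⟨-d, ?_⟩
        push_cast
        rw [pow_succ]; linear_combination -hc
    -- With `v = 2w + 1`, `v² - 1 = 4w(w + 1)`; only one of the coprime `w`, `w + 1` is even and it
    -- absorbs the whole power of two.
    have h2 : (2 : ℤ) ^ n ∣ v - 1 ∨ (2 : ℤ) ^ n ∣ v - (-1) := by
      obtain ⟨w, rfl⟩ := hodd
      have h3 : (2 : ℤ) ^ (n + 1) ∣ 4 * (w * (w + 1)) := by
        convert h1 using 1; ring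
      rcases n with _ | n
      · left; simp
      have h4 : (2 : ℤ) ^ n ∣ w * (w + 1) := by
        have : (2 : ℤ) ^ (n + 1 + 1) = 4 * 2 ^ n := by ring
        rw [this] at h3
        exact Int.dvd_of_mul_dvd_mul_left (by norm_num) h3
      rcases Int.even_or_odd w with hw | hw
      · have hc : IsCoprime ((2 : ℤ) ^ n) (w + 1) :=
          IsCoprime.pow_left (by
            obtain ⟨c, rfl⟩ := hw
            exact ⟨-c, 1, by ring⟩)
        left
        rw [pow_succ, show 2 * w + 1 - 1 = w * 2 by ring]
        exact mul_dvd_mul_right (hc.dvd_of_dvd_mul_right h4) 2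
      · have hc : IsCoprime ((2 : ℤ) ^ n) w :=
          IsCoprime.pow_left (by
            obtain ⟨c, rfl⟩ := hw
            exact ⟨-c, 1, by ring⟩)
        right
        rw [pow_succ, show 2 * w + 1 - -1 = (w + 1) * 2 by ring]
        exact mul_dvd_mul_right (hc.dvd_of_dvd_mul_left h4) 2
    rw [← hv]
    simp only [Finset.mem_insert, Finset.mem_singleton, Nat.add_sub_cancel]
    rcases h2 with h2 | h2 <;> rcases hlift _ h2 with h | h <;> simp [h]
  refine le_trans (Nat.card_le_card_of_injective
    (fun u => (⟨(u.1 : ZMod (2 ^ n)), key u.1 u.2⟩ :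
      ({1, -1, 1 + 2 ^ (n - 1), -1 + 2 ^ (n - 1)} : Finset (ZMod (2 ^ n))))) ?_) ?_
  · intro a b hab
    exact Subtype.ext (Units.ext (congrArg Subtype.val hab))
  · rw [Nat.card_eq_fintype_card, Fintype.card_coe]
    exact Finset.card_le_four

theorem MonoidHom.card_eq_card_ker_mul_card_range {G H : Type*} [Group G] [Group H] (f : G →* H) :
    Nat.card G = Nat.card f.ker * Nat.card f.range := by
  rw [← Subgroup.card_mul_index f.ker, Subgroup.index_ker]

theorem Subgroup.mem_zpowers_iff_of_mul_self_eq_one {G : Type*} [Group G] {z : G} (hz : z * z = 1)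
    {x : G} : x ∈ Subgroup.zpowers z ↔ x = 1 ∨ x = z := by
  constructor
  · rintro ⟨n, rfl⟩
    have hz' : z ^ (2 : ℤ) = 1 := by rw [zpow_two, hz]
    rcases Int.even_or_odd' n with ⟨m, rfl | rfl⟩
    · left; simp [zpow_mul, hz']
    · right; simp [zpow_add, zpow_mul, hz']
  · rintro (rfl | rfl)
    · exact one_mem _
    · exact Subgroup.mem_zpowers _

theorem IsPGroup.two_mul_card_dvd_card {G : Type*} [Group G] [Finite G] (hG : IsPGroup 2 G)
    {A B : Subgroup G} (h : Nat.card A < Nat.card B) :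
    2 * Nat.card A ∣ Nat.card B := by
  obtain ⟨n, hn⟩ := IsPGroup.iff_card.1 (hG.to_subgroup A)
  obtain ⟨m, hm⟩ := IsPGroup.iff_card.1 (hG.to_subgroup B)
  rw [hn, hm] at h ⊢
  rw [← pow_succ']
  exact pow_dvd_pow 2 ((Nat.pow_lt_pow_iff_right (by norm_num : 1 < 2)).1 h)

/-! ### `2`-groups without a normal four-group through `z` -/

/-- A maximal normal abelian subgroup of a finite `2`-group is self-centralizing. -/
theorem IsPGroup.centralizer_le_of_maximal {Q : Type*} [Group Q] [Finite Q] (hQ : IsPGroup 2 Q)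
    {z : Q} {B : Subgroup Q}
    (hB : Maximal (fun B : Subgroup Q => B.Normal ∧ z ∈ B ∧ ∀ x ∈ B, ∀ y ∈ B, x * y = y * x) B)
    {x : Q} (hx : ∀ b ∈ B, b * x = x * b) : x ∈ B := by
  have hBn := hB.prop.1
  by_contra hxB
  have hBC : B ≤ Subgroup.centralizer (B : Set Q) := fun b hb =>
    Subgroup.mem_centralizer_iff.2 fun c hc => hB.prop.2.2 c hc b hb
  have hlt : Nat.card B < Nat.card (Subgroup.centralizer (B : Set Q)) := by
    refine Set.ncard_lt_ncard (s := (B : Set Q)) (t := Subgroup.centralizer (B : Set Q)) ?_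
      (Set.toFinite _)
    exact Set.ssubset_iff_subset_ne.2 ⟨hBC, fun h =>
      hxB ((Set.ext_iff.1 h x).2 (Subgroup.mem_centralizer_iff.2 hx))⟩
  -- A `y` outside `B` that centralizes `B` and is central modulo `B` makes `⟨y⟩B` normal and
  -- abelian, against maximality.
  obtain ⟨y, hy, hyB, hyc⟩ := hQ.exists_central_mod B (Subgroup.centralizer (B : Set Q))
    (one_mem _) (fun x hx e he => mul_mem hx (hBC he))
    (fun x hx g => Subgroup.Normal.conj_mem inferInstance x hx g)
    (hQ.two_mul_card_dvd_card hlt)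
  have hyB' : ∀ b ∈ B, Commute b y := fun b hb => Subgroup.mem_centralizer_iff.1 hy b hb
  have hcen : ∀ q : Q ⧸ B, (y : Q ⧸ B) * q = q * (y : Q ⧸ B) := by
    intro q
    obtain ⟨g, rfl⟩ := QuotientGroup.mk_surjective q
    rw [← QuotientGroup.mk_mul, ← QuotientGroup.mk_mul, eq_comm, QuotientGroup.eq]
    convert hyc g using 1
    group
  have hn : (Subgroup.zpowers (y : Q ⧸ B)).Normal := ⟨by
    rintro _ ⟨n, rfl⟩ q
    refine ⟨n, ?_⟩
    have h1 : Commute (y : Q ⧸ B) q := hcen q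
    exact (mul_inv_eq_of_eq_mul (h1.zpow_left n).eq.symm).symm⟩
  set P := (Subgroup.zpowers (y : Q ⧸ B)).comap (QuotientGroup.mk' B) with hP
  have hBP : B ≤ P := fun b hb => by
    rw [hP, Subgroup.mem_comap, QuotientGroup.mk'_apply, (QuotientGroup.eq_one_iff b).2 hb]
    exact one_mem _
  have hPmem : ∀ g ∈ P, ∃ n : ℤ, ∃ b ∈ B, g = y ^ n * b := by
    rintro g ⟨n, hn⟩
    refine ⟨n, (y ^ n)⁻¹ * g, QuotientGroup.eq.1 ?_, by simp⟩
    simpa using hn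
  have hPc : ∀ g ∈ P, ∀ h ∈ P, g * h = h * g := by
    intro g hg h hh
    obtain ⟨n, b, hb, rfl⟩ := hPmem g hg
    obtain ⟨m, c, hc, rfl⟩ := hPmem h hh
    have hbc : Commute b c := hB.prop.2.2 b hb c hc
    have h1 : Commute (y ^ n) (y ^ m * c) :=
      (Commute.zpow_zpow_self y n m).mul_right ((hyB' c hc).symm.zpow_left n)
    have h2 : Commute b (y ^ m * c) := ((hyB' b hb).zpow_right m).mul_right hbc
    exact (h1.mul_left h2).eq
  have := hB.le_of_ge (y := P) ⟨hn.comap _, hBP hB.prop.2.1, hPc⟩ hBP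
  refine hyB (this ?_)
  exact Subgroup.mem_zpowers (y : Q ⧸ B)

theorem card_units_sq_eq_one_le {N n : ℕ} (hN : N = 2 ^ n) :
    Nat.card {u : (ZMod N)ˣ // u ^ 2 = 1} ≤ 4 := by
  subst hN
  exact ZMod.card_units_two_pow_sq_eq_one_le n

/-- A finite `2`-group with a central `z`, `z² = 1`, and no normal four-group
containing `z` has at most three generators. -/
theorem IsPGroup.index_le_eight_of_no_klein {Q : Type*} [Group Q] [Finite Q] (hQ : IsPGroup 2 Q)
    {z : Q} (hz : ∀ x, z * x = x * z) (hz2 : z * z = 1)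
    (h : ∀ a, a * a = 1 → (∀ x, a⁻¹ * x⁻¹ * a * x = 1 ∨ a⁻¹ * x⁻¹ * a * x = z) → a = 1 ∨ a = z)
    {Y : Subgroup Q} (hY : ∀ x, x * x ∈ Y) : Y.index ≤ 8 := by
  have hmz {x : Q} := Subgroup.mem_zpowers_iff_of_mul_self_eq_one (x := x) hz2
  have hZn : (Subgroup.zpowers z).Normal := ⟨fun n hn g => by
    rcases hmz.1 hn with rfl | rfl
    · simp
    · rw [← hz]; simp⟩
  obtain ⟨B, -, hB⟩ := Finite.exists_le_maximal
    (p := fun B : Subgroup Q => B.Normal ∧ z ∈ B ∧ ∀ x ∈ B, ∀ y ∈ B, x * y = y * x)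
    (a := Subgroup.zpowers z) ⟨hZn, Subgroup.mem_zpowers z, by
      rintro _ ⟨n, rfl⟩ _ ⟨m, rfl⟩
      exact (Commute.zpow_zpow_self z n m).eq⟩
  have hBn := hB.prop.1
  let Ω : Subgroup Q :=
    { carrier := {b | b ∈ B ∧ b * b = 1}
      one_mem' := ⟨one_mem _, mul_one 1⟩
      mul_mem' := by
        rintro a b ⟨ha, ha2⟩ ⟨hb, hb2⟩
        refine ⟨mul_mem ha hb, ?_⟩
        have e : a * b * (a * b) = a * (b * a) * b := by group
        rw [e, hB.prop.2.2 b hb a ha]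
        have e' : a * (a * b) * b = (a * a) * (b * b) := by group
        rw [e', ha2, hb2, one_mul]
      inv_mem' := by
        rintro a ⟨ha, ha2⟩
        exact ⟨inv_mem ha, by rw [← mul_inv_rev, ha2, inv_one]⟩ }
  -- A larger `Ω` would contain a second coset of `⟨z⟩` central modulo `⟨z⟩`, which `h` excludes.
  -- Hence `B` is cyclic.
  have hΩ : Nat.card Ω ≤ 2 := by
    by_contra hcon
    have hZΩ : Subgroup.zpowers z ≤ Ω := by
      rw [Subgroup.zpowers_le]
      exact ⟨hB.prop.2.1, hz2⟩
    have hZ2 : Nat.card (Subgroup.zpowers z) ≤ 2 := by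
      rw [Nat.card_zpowers]
      exact Nat.le_of_dvd two_pos (orderOf_dvd_of_pow_eq_one (by rw [pow_two, hz2]))
    obtain ⟨x, hx, hxZ, hxc⟩ := hQ.exists_central_mod (Subgroup.zpowers z) (Ω : Set Q)
      (one_mem Ω) (fun x hx e he => mul_mem hx (hZΩ he))
      (fun x hx g => ⟨hBn.conj_mem x hx.1 g, by
        have e : g * x * g⁻¹ * (g * x * g⁻¹) = g * (x * x) * g⁻¹ := by group
        rw [e, hx.2]; simp⟩)
      (hQ.two_mul_card_dvd_card (by omega))
    exact hxZ (hmz.2 (h x hx.2 fun g => hmz.1 (hxc g)))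
  let _ : CommGroup B :=
    { (inferInstance : Group B) with
      mul_comm := fun a b => Subtype.ext (hB.prop.2.2 a a.2 b b.2) }
  have hB2 : Nat.card {b : B // b ^ 2 = 1} ≤ 2 := by
    refine le_trans (Nat.card_le_card_of_injective
      (fun b => (⟨b.1.1, b.1.2, by
        have := congrArg Subtype.val b.2
        rw [pow_two] at this
        exact this⟩ : Ω)) fun a b hab => ?_) hΩ
    exact Subtype.ext (Subtype.ext (Subtype.mk.inj hab))
  have hcyc : IsCyclic B := (hQ.to_subgroup B).isCyclic_of_card_sq_eq_one_le hB2
  obtain ⟨n, hn⟩ := IsPGroup.iff_card.1 (hQ.to_subgroup B)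
  let ψ : Q →* (ZMod (Nat.card B))ˣ :=
    (IsCyclic.mulAutMulEquiv B).toMonoidHom.comp MulAut.conjNormal
  have hker : ψ.ker = B := by
    ext x
    have h1 : x ∈ ψ.ker ↔ (MulAut.conjNormal x : MulAut B) = 1 := by
      rw [MonoidHom.mem_ker]
      exact map_eq_one_iff _ (IsCyclic.mulAutMulEquiv B).injective
    rw [h1]
    constructor
    · intro hx
      refine hQ.centralizer_le_of_maximal hB fun b hb => ?_
      have := congrArg Subtype.val (DFunLike.congr_fun hx (⟨b, hb⟩ : B))
      rw [MulAut.conjNormal_apply, MulAut.one_apply, mul_inv_eq_iff_eq_mul] at this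
      exact this.symm
    · intro hx
      ext b
      rw [MulAut.conjNormal_apply, MulAut.one_apply, mul_inv_eq_iff_eq_mul]
      exact hB.prop.2.2 x hx b b.2
  have hR2 : Nat.card {r : ψ.range // r ^ 2 = 1} ≤ 4 := by
    refine le_trans (Nat.card_le_card_of_injective
      (fun r => (⟨r.1.1, congrArg Subtype.val r.2⟩ : {u : (ZMod (Nat.card B))ˣ // u ^ 2 = 1}))
      fun a b hab => Subtype.ext (Subtype.ext (Subtype.mk.inj hab))) (card_units_sq_eq_one_le hn)
  -- `ψ` embeds `Q / B` in the units. The image of `Y` contains the squares of `Q / B`, costing a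
  -- factor `4`, and `Y ∩ B` contains the squares of `B`, costing a factor `2`.
  let θ : Y →* (ZMod (Nat.card B))ˣ := ψ.comp Y.subtype
  have hR : Nat.card ψ.range ≤ 4 * Nat.card θ.range := by
    rw [card_sq_eq_one_mul_card_range (A := ψ.range)]
    refine Nat.mul_le_mul hR2 (Nat.card_le_card_of_injective
      (fun r => (⟨r.1.1, ?_⟩ : θ.range)) fun a b hab =>
        Subtype.ext (Subtype.ext (Subtype.mk.inj hab)))
    obtain ⟨⟨_, q, rfl⟩, hs⟩ := r.2
    rw [← hs]
    exact ⟨⟨q * q, hY q⟩, by simp [θ, pow_two]⟩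
  have hK : Nat.card B ≤ 2 * Nat.card θ.ker := by
    refine (card_sq_eq_one_mul_card_range (A := B)).trans_le ?_
    refine Nat.mul_le_mul hB2 (Nat.card_le_card_of_injective
      (fun r => (⟨⟨r.1.1, ?_⟩, ?_⟩ : θ.ker)) fun a b hab => Subtype.ext (Subtype.ext
        (congrArg (fun t : θ.ker => (t.1 : Q)) hab)))
    · obtain ⟨s, hs⟩ := r.2
      rw [← hs]
      have := hY s
      rw [← pow_two] at this
      exact this
    · have : (r.1 : Q) ∈ ψ.ker := hker.ge r.1.2
      exact this
  have h1 : Nat.card Q = Nat.card B * Nat.card ψ.range := by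
    rw [ψ.card_eq_card_ker_mul_card_range, hker]
  have h2 := θ.card_eq_card_ker_mul_card_range
  have h3 := Y.card_mul_index
  have h4 : 0 < Nat.card Y := Nat.card_pos
  refine Nat.le_of_mul_le_mul_left ?_ h4
  rw [h3, h1, h2]
  calc _ ≤ (2 * Nat.card θ.ker) * (4 * Nat.card θ.range) := Nat.mul_le_mul hK hR
    _ = _ := by ring

/-! ### Divisibility of the sign sums -/

namespace IsInvariantSign

variable {Γ : Type*} [Group Γ] {ε : Γ → ℤ} {C K : Subgroup Γ}

/-- In `C / ker ε` the image of `K` is `{1, z}` with `z` central, and `hno` rules out normal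
four-groups containing it. -/
theorem card_le_eight_mul [Finite Γ] (hΓ : IsPGroup 2 Γ) (h : IsInvariantSign ε C K)
    {Y : Subgroup Γ} (hKY : K ≤ Y) (hYC : Y ≤ C) (hsq : ∀ c ∈ C, c * c ∈ Y)
    {z : Γ} (hzK : z ∈ K) (hz : ε z = -1)
    (hno : ∀ a ∈ C, a * a ∈ K → (∀ x ∈ C, a⁻¹ * x⁻¹ * a * x ∈ K) → ε (a * a) = 1 → a ∈ K) :
    Nat.card C ≤ 8 * Nat.card Y := by
  have hmem : ∀ x, ε x = 1 → x ∈ K := fun x hx => by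
    by_contra hxK
    rw [h.zero x hxK] at hx
    exact zero_ne_one hx
  let N : Subgroup C :=
    { carrier := {c | ε c = 1}
      one_mem' := h.map_one
      mul_mem' := by
        intro a b ha hb
        change ε (a * b) = 1
        rw [h.mul _ (hmem _ ha) _ (hmem _ hb), ha, hb, one_mul]
      inv_mem' := by
        intro a ha
        have h1 := h.mul _ (hmem _ ha) _ (K.inv_mem (hmem _ ha))
        rw [mul_inv_cancel, h.map_one, ha, one_mul] at h1
        exact h1.symm }
  have hN : N.Normal := ⟨fun n hn g => by
    have := h.conj' (C.inv_mem g.2) (n : Γ)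
    rw [inv_inv] at this
    exact this.trans hn⟩
  have hNmem : ∀ c : C, (c : C ⧸ N) = 1 ↔ ε c = 1 := fun c => QuotientGroup.eq_one_iff c
  have hzC := h.le hzK
  have hzinv : ε z⁻¹ = -1 := by
    have h1 := h.mul _ hzK _ (K.inv_mem hzK)
    rw [mul_inv_cancel, h.map_one, hz] at h1
    omega
  let z' : C := ⟨z, hzC⟩
  have hNz : ∀ c : C, (c : C ⧸ N) = (z' : C ⧸ N) ↔ ε c = -1 := fun c => by
    rw [eq_comm, QuotientGroup.eq]
    change ε (z⁻¹ * c) = 1 ↔ _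
    rw [h.mul_left _ (K.inv_mem hzK), hzinv]
    omega
  have key : (((Y.subgroupOf C).map (QuotientGroup.mk' N))).index ≤ 8 := by
    refine ((hΓ.to_subgroup C).to_quotient N).index_le_eight_of_no_klein (z := (z' : C ⧸ N))
      ?_ ?_ ?_ ?_
    · intro q
      obtain ⟨g, rfl⟩ := QuotientGroup.mk_surjective q
      rw [← QuotientGroup.mk_mul, ← QuotientGroup.mk_mul, eq_comm, QuotientGroup.eq]
      change ε (((g : Γ) * z)⁻¹ * (z * g)) = 1
      have e : ((g : Γ) * z)⁻¹ * (z * g) = z⁻¹ * ((g : Γ)⁻¹ * z * g) := by group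
      rw [e, h.mul_left _ (K.inv_mem hzK), h.conj' g.2, hzinv, hz]
      norm_num
    · rw [← QuotientGroup.mk_mul, hNmem]
      change ε (z * z) = 1
      rw [h.mul z hzK z hzK, hz]
      norm_num
    · intro q hq hqc
      obtain ⟨a, rfl⟩ := QuotientGroup.mk_surjective q
      rw [← QuotientGroup.mk_mul, hNmem] at hq
      have haK : (a : Γ) ∈ K := by
        refine hno a a.2 (hmem _ hq) (fun x hx => ?_) hq
        have h1 := hqc ((⟨x, hx⟩ : C) : C ⧸ N)
        rw [← QuotientGroup.mk_inv, ← QuotientGroup.mk_inv, ← QuotientGroup.mk_mul,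
          ← QuotientGroup.mk_mul, ← QuotientGroup.mk_mul, hNmem, hNz] at h1
        -- `ε` vanishes outside `K`, so a commutator of sign `±1` lies in `K`.
        by_contra hcon
        have h2 := h.zero _ hcon
        change ε ((a : Γ)⁻¹ * x⁻¹ * a * x) = 1 ∨ ε ((a : Γ)⁻¹ * x⁻¹ * a * x) = -1 at h1
        omega
      rw [hNmem, hNz]
      exact h.one_or _ haK
    · intro q
      obtain ⟨a, rfl⟩ := QuotientGroup.mk_surjective q
      exact ⟨a * a, hsq a a.2, rfl⟩
  have hindex : (Y.subgroupOf C).index ≤ 8 := by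
    rw [← Subgroup.index_comap_of_surjective _ (QuotientGroup.mk'_surjective N),
      Subgroup.comap_map_eq, QuotientGroup.ker_mk', sup_eq_left.2] at key
    · exact key
    · intro c hc
      exact hKY (hmem _ hc)
  have h1 := (Y.subgroupOf C).card_mul_index
  rw [Nat.card_congr (Subgroup.subgroupOfEquivOfLe hYC).toEquiv] at h1
  rw [← h1, mul_comm]
  exact Nat.mul_le_mul_right _ hindex

/-- The kernel of `x ↦ ε([a, x])` on `C`. -/
def commKer (h : IsInvariantSign ε C K) (a : Γ) (hcK : ∀ x ∈ C, a⁻¹ * x⁻¹ * a * x ∈ K) :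
    Subgroup Γ where
  carrier := {x | x ∈ C ∧ ε (a⁻¹ * x⁻¹ * a * x) = 1}
  one_mem' := ⟨C.one_mem, by simpa using h.map_one⟩
  mul_mem' := by
    rintro x y ⟨hx, hx1⟩ ⟨hy, hy1⟩
    exact ⟨C.mul_mem hx hy, by rw [h.comm_mul hy (hcK y hy), hx1, hy1, one_mul]⟩
  inv_mem' := by
    rintro x ⟨hx, hx1⟩
    refine ⟨C.inv_mem hx, ?_⟩
    have h1 := h.comm_mul (a := a) (x := x) (C.inv_mem hx) (hcK _ (C.inv_mem hx))
    rw [mul_inv_cancel, hx1, one_mul] at h1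
    rw [← h1]
    simpa using h.map_one

theorem mem_commKer (h : IsInvariantSign ε C K) {a : Γ}
    {hcK : ∀ x ∈ C, a⁻¹ * x⁻¹ * a * x ∈ K} {x : Γ} :
    x ∈ h.commKer a hcK ↔ x ∈ C ∧ ε (a⁻¹ * x⁻¹ * a * x) = 1 := Iff.rfl

/-- If the squares of `C` lie in `Y ≥ K` and `|C : Y| > 2 ^ (3m)`, then
`∑_{x ∈ C} ε(x²)` is divisible by `2 ^ (m + 1) |K|`. -/
theorem two_pow_dvd_signSum [Fintype Γ] (hΓ : IsPGroup 2 Γ) (n : ℕ) :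
    ∀ (C K Y : Subgroup Γ) (ε : Γ → ℤ) (m : ℕ), IsInvariantSign ε C K → K ≤ Y → Y ≤ C →
      (∀ c ∈ C, c * c ∈ Y) → 2 ^ (3 * m) * Nat.card Y < Nat.card C →
      Nat.card C ≤ Nat.card K + n → (2 ^ (m + 1) * Nat.card K : ℤ) ∣ signSum C ε := by
  -- `n` bounds `|C| - |K|`, which drops when `C` shrinks or `K` grows.
  induction n with
  | zero =>
    intro C K Y ε m h hKY hYC hsq hlt hn
    have h1 : Nat.card K ≤ Nat.card Y := Subgroup.card_le_of_le hKY
    have h2 : Nat.card Y ≤ 2 ^ (3 * m) * Nat.card Y := Nat.le_mul_of_pos_left _ (by positivity)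
    omega
  | succ n ih =>
    intro C K Y ε m h hKY hYC hsq hlt hn
    have hY1 : Nat.card Y ≤ 2 ^ (3 * m) * Nat.card Y := Nat.le_mul_of_pos_left _ (by positivity)
    have hKY' : Nat.card K ≤ Nat.card Y := Subgroup.card_le_of_le hKY
    have hKpos : 0 < Nat.card K := Nat.card_pos
    have hexists := hΓ.exists_central_order_two_mod h.normal (hKY'.trans_lt (hY1.trans_lt hlt))
    rcases m with _ | m
    · obtain ⟨a, haC, haK, ha2, hcK⟩ := hexists
      simpa using h.two_mul_card_dvd haC haK ha2 hcK
    have hpow : 2 ^ (3 * (m + 1)) = 8 * 2 ^ (3 * m) := by ring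
    have hppos : 0 < 2 ^ (3 * m) := by positivity
    rw [hpow, mul_assoc] at hlt
    by_cases hgood : ∃ a ∈ C, a ∉ K ∧ a * a ∈ K ∧ (∀ x ∈ C, a⁻¹ * x⁻¹ * a * x ∈ K) ∧
        ε (a * a) = 1
    swap
    · exfalso
      obtain ⟨a, haC, haK, ha2, hcK⟩ := hexists
      have hεa : ε (a * a) = -1 := (h.one_or _ ha2).resolve_left fun h1 =>
        hgood ⟨a, haC, haK, ha2, hcK, h1⟩
      have := h.card_le_eight_mul hΓ hKY hYC hsq ha2 hεa fun b hb hb2 hbc hb1 => by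
        by_contra hbK
        exact hgood ⟨b, hb, hbK, hb2, hbc, hb1⟩
      have h2 : Nat.card Y ≤ 2 ^ (3 * m) * Nat.card Y := Nat.le_mul_of_pos_left _ hppos
      omega
    obtain ⟨a, haC, haK, ha2, hcK, hε⟩ := hgood
    set A := K.adjoinRoot a (h.normal a haC) ha2 with hA
    have hcardA : Nat.card A = 2 * Nat.card K := Subgroup.card_eq_two_mul A K a haK fun g => Iff.rfl
    have haA : a ∈ A := Or.inr (by simp)
    by_cases htriv : ∀ x ∈ C, ε (a⁻¹ * x⁻¹ * a * x) = 1
    · by_cases haY : a ∈ Y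
      · have hAY : A ≤ Y := by
          rintro y (hy | hy)
          · exact hKY hy
          · simpa using Y.mul_mem haY (hKY hy)
        -- The index of `Y` is unchanged, and the factor gained from `|A| = 2|K|` is spent on
        -- averaging the two extensions.
        have hd : ∀ δ : ℤ, δ = 1 ∨ δ = -1 →
            (2 ^ (m + 1 + 1) * Nat.card A : ℤ) ∣ signSum C (fun y => ε y + δ * ε (a⁻¹ * y)) :=
          fun δ hδ => ih C A Y _ (m + 1)
            (h.extend haC haK ha2 hε le_rfl h.le haC hcK htriv hδ) hAY hYC hsq
            (by rw [hpow, mul_assoc]; exact hlt) (by omega)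
        have h1 := dvd_add (hd 1 (Or.inl rfl)) (hd (-1) (Or.inr rfl))
        rw [signSum_extend, hcardA] at h1
        obtain ⟨c, hc⟩ := h1
        refine ⟨c, ?_⟩
        push_cast at hc
        linarith
      -- Here `A` does not fit inside `Y`; instead the sum over `C` is twice the sum over a subgroup
      -- of index two, which allows `m` to drop by one.
      · obtain ⟨L, hYL, hLC, haL, hL⟩ := Subgroup.exists_index_two_avoiding hYC hsq haC haY
        have hsqL : ∀ c ∈ C, c * c ∈ L := fun c hc => hYL (hsq c hc)
        have hLa : ∀ g, a⁻¹ * g * a ∈ L ↔ g ∈ L := fun g => by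
          refine ⟨fun hg => ?_, fun hg => Subgroup.conj_mem_of_sq_mem hLC hsqL haC hg⟩
          have := Subgroup.conj_mem_of_sq_mem hLC hsqL (C.inv_mem haC) hg
          convert this using 1; group
        have hcardC := Subgroup.card_eq_two_mul C L a haL hL
        have h1 := ih L K Y ε m (h.mono hLC (hKY.trans hYL)) hKY hYL
          (fun c hc => hsq c (hLC hc)) (by omega) (by
            have : 0 < Nat.card L := Nat.card_pos
            omega)
        rw [signSum_eq_two_mul C L ε a haL hL hLa fun x hx => by
          rw [h.mul_self_mul haC ha2 (hcK x (hLC hx)), htriv x (hLC hx), hε, mul_one, mul_one]]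
        have e : (2 ^ (m + 1 + 1) * Nat.card K : ℤ) = 2 * (2 ^ (m + 1) * Nat.card K) := by ring
        rw [e]
        exact mul_dvd_mul_left 2 h1
    · push Not at htriv
      obtain ⟨g, hgC, hg⟩ := htriv
      have hg' : ε (a⁻¹ * g⁻¹ * a * g) = -1 := (h.one_or _ (hcK g hgC)).resolve_left hg
      set H := h.commKer a hcK with hH
      have hHC : H ≤ C := fun x hx => hx.1
      have haH : a ∈ H := ⟨haC, by simpa using h.map_one⟩
      have hgi : ε (a⁻¹ * g⁻¹⁻¹ * a * g⁻¹) = -1 := by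
        have h1 := h.comm_mul (a := a) (x := g) (C.inv_mem hgC) (hcK _ (C.inv_mem hgC))
        have h2 : ε (a⁻¹ * (g * g⁻¹)⁻¹ * a * (g * g⁻¹)) = 1 := by simpa using h.map_one
        rw [h2, hg'] at h1
        omega
      have hKH : K ≤ H := by
        intro k hk
        refine ⟨h.le hk, ?_⟩
        have e : a⁻¹ * k⁻¹ * a * k = (a⁻¹ * k⁻¹ * a) * k := by group
        rw [e, h.mul_right _ hk, h.conj' haC, ← h.mul_right _ hk, inv_mul_cancel, h.map_one]
      have hHg : ∀ x, g⁻¹ * x * g ∈ H ↔ x ∈ H := by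
        intro x
        rw [hH, h.mem_commKer, h.mem_commKer]
        have hxC : g⁻¹ * x * g ∈ C ↔ x ∈ C := by
          rw [C.mul_mem_cancel_right hgC, C.mul_mem_cancel_left (C.inv_mem hgC)]
        rw [hxC]
        refine and_congr_right fun hx => ?_
        rw [h.comm_mul hgC (hcK g hgC), h.comm_mul hx (hcK x hx), hg', hgi]
        ring_nf
      have hcover : ∀ x ∈ C, x ∈ H ∨ g⁻¹ * x ∈ H := by
        intro x hx
        rcases h.one_or _ (hcK x hx) with h1 | h1
        · exact Or.inl ⟨hx, h1⟩
        · refine Or.inr ⟨C.mul_mem (C.inv_mem hgC) hx, ?_⟩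
          rw [h.comm_mul hx (hcK x hx), h1, hgi]
          norm_num
      have hcardC := Subgroup.card_le_two_mul C H g hcover
      have hsqH : ∀ c ∈ H, c * c ∈ H := fun c hc => H.mul_mem hc hc
      have hn' : ∀ l ∈ Y ⊓ H, a⁻¹ * l * a ∈ Y ⊓ H := fun l hl =>
        Subgroup.conj_mem_of_sq_mem (C := H) inf_le_right
          (fun c hc => ⟨hsq c (hHC hc), hsqH c hc⟩) haH hl
      have ha2' : a * a ∈ Y ⊓ H := ⟨hsq a haC, hsqH a haH⟩
      -- `a` is adjoined so that `A ≤ Y'`. Passing to `H` and to `Y'` each lose at most a factor `2`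
      -- in the index, within the available `8`.
      set Y' := (Y ⊓ H).adjoinRoot a hn' ha2' with hY'
      have hYY' : Y ⊓ H ≤ Y' := fun y hy => Or.inl hy
      have haY' : a ∈ Y' := Or.inr (by simp)
      have hcardY' : Nat.card Y' ≤ 2 * Nat.card Y :=
        (Subgroup.card_le_two_mul Y' (Y ⊓ H) a fun y hy => hy).trans
          (Nat.mul_le_mul_left 2 (Subgroup.card_le_of_le inf_le_left))
      have hAY' : A ≤ Y' := by
        rintro y (hy | hy)
        · exact hYY' ⟨hKY hy, hKH hy⟩
        · simpa using Y'.mul_mem haY' (hYY' ⟨hKY hy, hKH hy⟩)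
      have hY'H : Y' ≤ H := by
        rintro y (hy | hy)
        · exact hy.2
        · simpa using H.mul_mem haH hy.2
      have hcardH : Nat.card H ≤ Nat.card C := Subgroup.card_le_of_le hHC
      have hd := ih H A Y' _ m
        (h.extend haC haK ha2 hε hHC hKH haH (fun x hx => hcK x (hHC hx)) (fun x hx => hx.2)
          (Or.inl rfl)) hAY' hY'H
        (fun c hc => hYY' ⟨hsq c (hHC hc), hsqH c hc⟩)
        (by
          have := Nat.mul_le_mul_left (2 ^ (3 * m)) hcardY'
          have e : 2 ^ (3 * m) * (2 * Nat.card Y) = 2 * (2 ^ (3 * m) * Nat.card Y) := by ring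
          have : 0 < 2 ^ (3 * m) * Nat.card Y := Nat.mul_pos hppos Nat.card_pos
          omega) (by omega)
      -- Since `ε([a, g]) = -1`, conjugation by `g` swaps the two extensions.
      have hconj : signSum H (fun y => ε y + 1 * ε (a⁻¹ * y))
          = signSum H (fun y => ε y + (-1) * ε (a⁻¹ * y)) := by
        rw [← signSum_conj H _ g hHg]
        congr 1
        funext y
        have e : a⁻¹ * (g⁻¹ * y * g) = (a⁻¹ * g⁻¹ * a * g) * (g⁻¹ * (a⁻¹ * y) * g) := by group
        rw [e, h.mul_left _ (hcK g hgC), h.conj' hgC, h.conj' hgC, hg', one_mul]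
      have hsum := signSum_extend H ε a
      rw [← hconj] at hsum
      have hF : signSum C ε = signSum H ε := by
        refine signSum_eq_of_neg C H hHC ε a haH fun x hx hxH => ?_
        have : ε (a⁻¹ * x⁻¹ * a * x) = -1 :=
          (h.one_or _ (hcK x hx)).resolve_left fun h1 => hxH ⟨hx, h1⟩
        rw [h.mul_self_mul haC ha2 (hcK x hx), this, hε]
        ring
      rw [hF]
      have hsum' : signSum H ε = signSum H (fun y => ε y + 1 * ε (a⁻¹ * y)) := by linarith
      rw [hsum']
      rw [hcardA] at hd
      convert hd using 1
      push_cast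
      ring

end IsInvariantSign

/-- If `C` is a `2`-subgroup and `|C : Y| > 2 ^ (3m)` with `Y ≤ C` containing all squares, then the
number of solutions of `x² = 1` in `C` is divisible by `2 ^ (m + 1)`. -/
theorem IsPGroup.two_pow_dvd_card_sq_eq_one {Γ : Type*} [Group Γ] [Finite Γ] (hΓ : IsPGroup 2 Γ)
    {C Y : Subgroup Γ} (hYC : Y ≤ C) (hsq : ∀ c ∈ C, c * c ∈ Y) {m : ℕ}
    (hlt : 2 ^ (3 * m) * Nat.card Y < Nat.card C) :
    2 ^ (m + 1) ∣ Nat.card {x : Γ // x ∈ C ∧ x * x = 1} := by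
  classical
  have := Fintype.ofFinite Γ
  -- For the trivial sign on `K = 1`, the sum counts the solutions of `x² = 1`.
  have h : IsInvariantSign (fun x : Γ => if x = 1 then 1 else 0) C ⊥ := by
    refine ⟨bot_le, ?_, ?_, ?_, ?_, ?_⟩ <;> simp +contextual
  have h1 := IsInvariantSign.two_pow_dvd_signSum hΓ (Nat.card C) C ⊥ Y _ m h bot_le hYC hsq hlt
    (Nat.le_add_left _ _)
  have h2 : signSum C (fun x : Γ => if x = 1 then 1 else 0)
      = (Nat.card {x : Γ // x ∈ C ∧ x * x = 1} : ℤ) := by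
    rw [Nat.card_eq_fintype_card, Fintype.card_subtype, Finset.card_filter, signSum]
    push_cast
    refine Finset.sum_congr rfl fun x _ => ?_
    by_cases hx : x ∈ C <;> simp [hx]
  rw [h2, Subgroup.card_bot, Nat.cast_one, mul_one] at h1
  exact_mod_cast h1

/-! ### Maximality of `E` and its automorphisms -/

/-- For a maximal normal elementary abelian subgroup `E`, the number of solutions of `x² = 1` in
the centralizer of `E` is not a multiple of `2|E|`. -/
theorem IsMaximalNormalElementaryAbelian.not_two_mul_card_dvd {G : Type*} [Group G] [Finite G]
    (hG : IsPGroup 2 G) {E : Subgroup G} (hE : IsMaximalNormalElementaryAbelian 2 E) :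
    ¬ 2 * Nat.card E ∣ Nat.card {x : G // x ∈ Subgroup.centralizer (E : Set G) ∧ x * x = 1} := by
  intro hdvd
  have hEn : E.Normal := hE.prop.1
  have hEc : ∀ a ∈ E, ∀ b ∈ E, a * b = b * a := fun a ha b hb =>
    congrArg Subtype.val (hE.prop.2.1 ⟨a, ha⟩ ⟨b, hb⟩)
  have hE2 : ∀ a ∈ E, a * a = 1 := fun a ha => by
    have := congrArg Subtype.val (hE.prop.2.2 ⟨a, ha⟩)
    rw [pow_two] at this
    exact this
  obtain ⟨x, ⟨hxC, hx2⟩, hxE, hx⟩ := hG.exists_central_mod E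
    {x | x ∈ Subgroup.centralizer (E : Set G) ∧ x * x = 1} ⟨one_mem _, mul_one 1⟩
    (by
      rintro x ⟨hx, hx2⟩ e he
      refine ⟨mul_mem hx (Subgroup.mem_centralizer_iff.2 fun c hc => hEc c hc e he), ?_⟩
      have h1 := Subgroup.mem_centralizer_iff.1 hx e he
      have e1 : x * e * (x * e) = x * (e * x) * e := by group
      have e2 : x * (x * e) * e = (x * x) * (e * e) := by group
      rw [e1, h1, e2, hx2, hE2 e he, one_mul])
    (by
      rintro x ⟨hx, hx2⟩ g
      refine ⟨Subgroup.Normal.conj_mem inferInstance x hx g, ?_⟩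
      have e : g * x * g⁻¹ * (g * x * g⁻¹) = g * (x * x) * g⁻¹ := by group
      rw [e, hx2]; simp)
    hdvd
  have hxc : ∀ e ∈ E, e * x = x * e := Subgroup.mem_centralizer_iff.1 hxC
  have hn : ∀ l ∈ E, x⁻¹ * l * x ∈ E := fun l hl => by simpa using hEn.conj_mem l hl x⁻¹
  have hx2E : x * x ∈ E := hx2 ▸ one_mem E
  -- `E ∪ xE` is normal because `x` is central modulo `E`, and elementary abelian because `x`
  -- commutes with `E` and `x² = 1`.
  set N := E.adjoinRoot x hn hx2E with hN
  have hNmem : ∀ y ∈ N, ∃ e ∈ E, y = e ∨ y = x * e := by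
    rintro y (hy | hy)
    · exact ⟨y, hy, Or.inl rfl⟩
    · exact ⟨_, hy, Or.inr (by simp)⟩
  have hle : E ≤ N := fun y hy => Or.inl hy
  refine hxE (hE.le_of_ge (y := N) ⟨⟨?_⟩, ?_, ?_⟩ hle (Or.inr (by simp)))
  · rintro y (hy | hy) g
    · exact Or.inl (hEn.conj_mem y hy g)
    · right
      have e : x⁻¹ * (g * y * g⁻¹) = (x⁻¹ * g⁻¹⁻¹ * x * g⁻¹) * (g * (x⁻¹ * y) * g⁻¹) := by group
      rw [e]
      exact mul_mem (hx g⁻¹) (hEn.conj_mem _ hy g)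
  · rintro ⟨y, hy⟩ ⟨w, hw⟩
    apply Subtype.ext
    change y * w = w * y
    obtain ⟨e, he, hy⟩ := hNmem y hy
    obtain ⟨f, hf, hw⟩ := hNmem w hw
    have c1 : Commute e x := hxc e he
    have c2 : Commute f x := hxc f hf
    have c3 : Commute e f := hEc e he f hf
    rcases hy with rfl | rfl <;> rcases hw with rfl | rfl
    · exact c3.eq
    · exact (c1.mul_right c3).eq
    · exact (c2.symm.mul_left c3).eq
    · exact (((Commute.refl x).mul_right c2.symm).mul_left (c1.mul_right c3)).eq
  · rintro ⟨y, hy⟩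
    apply Subtype.ext
    change y ^ 2 = 1
    rw [pow_two]
    obtain ⟨e, he, rfl | rfl⟩ := hNmem y hy
    · exact hE2 _ he
    · have e1 : x * e * (x * e) = x * (e * x) * e := by group
      have e2 : x * (x * e) * e = (x * x) * (e * e) := by group
      rw [e1, hxc e he, e2, hx2, hE2 e he, one_mul]

theorem Subgroup.card_closure_finset_le {A : Type*} [Group A] [Finite A]
    (hA : IsElementaryAbelian 2 A) (s : Finset A) :
    Nat.card (Subgroup.closure (s : Set A)) ≤ 2 ^ s.card := by
  classical
  induction s using Finset.induction_on with
  | empty => simp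
  | insert a s ha ih =>
    have hn : ∀ l ∈ Subgroup.closure (s : Set A), a⁻¹ * l * a ∈ Subgroup.closure (s : Set A) :=
      fun l hl => by rw [mul_assoc, hA.1 l a, inv_mul_cancel_left]; exact hl
    have h2 : a * a ∈ Subgroup.closure (s : Set A) := by
      rw [← pow_two, hA.2 a]; exact one_mem _
    have hle : Subgroup.closure ((insert a s : Finset A) : Set A)
        ≤ (Subgroup.closure (s : Set A)).adjoinRoot a hn h2 := by
      rw [Subgroup.closure_le, Finset.coe_insert, Set.insert_subset_iff]
      exact ⟨Or.inr (by simp), fun x hx => Or.inl (Subgroup.subset_closure hx)⟩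
    rw [Finset.card_insert_of_notMem ha, pow_succ']
    exact (Subgroup.card_le_two_mul _ _ a fun g hg => hle hg).trans (Nat.mul_le_mul_left 2 ih)

theorem IsElementaryAbelian.card_le_two_pow_rank {A : Type*} [Group A] [Finite A]
    (hA : IsElementaryAbelian 2 A) : Nat.card A ≤ 2 ^ Group.rank A := by
  obtain ⟨s, hs, hc⟩ := Group.rank_spec A
  have := Subgroup.card_closure_finset_le hA s
  rwa [hc, Subgroup.card_top, hs] at this

/-- The product is `|GL_e(2)|`; pulling `2 ^ i` out of each factor leaves an odd number and the
exponent `0 + 1 + ⋯ + (e-1)`. -/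
theorem Nat.le_of_two_pow_dvd_prod_two_pow_sub {e j : ℕ}
    (h : 2 ^ j ∣ ∏ i : Fin e, (2 ^ e - 2 ^ (i : ℕ))) : j ≤ e * (e - 1) / 2 := by
  have h1 : ∏ i : Fin e, (2 ^ e - 2 ^ (i : ℕ))
      = 2 ^ (e * (e - 1) / 2) * ∏ i : Fin e, (2 ^ (e - (i : ℕ)) - 1) := by
    rw [← Finset.sum_range_id, Finset.sum_range, ← Finset.prod_pow_eq_pow_sum,
      ← Finset.prod_mul_distrib]
    refine Finset.prod_congr rfl fun i _ => ?_
    rw [Nat.mul_sub, ← pow_add, mul_one, Nat.add_sub_cancel' i.2.le]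
  rw [h1] at h
  have h2 : Nat.Coprime (2 ^ j) (∏ i : Fin e, (2 ^ (e - (i : ℕ)) - 1)) := by
    refine Nat.Coprime.pow_left j (Nat.Coprime.prod_right fun i _ => ?_)
    rw [Nat.coprime_two_left]
    refine Nat.Even.sub_odd Nat.one_le_two_pow ?_ odd_one
    exact (even_two).pow_of_ne_zero (Nat.sub_ne_zero_of_lt i.2)
  exact (Nat.pow_dvd_pow_iff_le_right' (b := 0)).1 (h2.dvd_of_dvd_mul_right h)

/-- Additive automorphisms of an `𝔽₂`-space are linear, so this is the order of `GL_e(2)`. -/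
theorem IsElementaryAbelian.card_mulAut {A : Type*} [Group A] [Finite A]
    (hA : IsElementaryAbelian 2 A) {e : ℕ} (he : Nat.card A = 2 ^ e) :
    Nat.card (MulAut A) = ∏ i : Fin e, (2 ^ e - 2 ^ (i : ℕ)) := by
  classical
  let _ : CommGroup A := { (inferInstance : Group A) with mul_comm := hA.1 }
  let _ : Module (ZMod 2) (Additive A) := AddCommGroup.zmodModule fun x => hA.2 x.toMul
  have hfin : Module.finrank (ZMod 2) (Additive A) = e := by
    have := Fintype.ofFinite (Additive A)
    have h := Module.card_eq_pow_finrank (K := ZMod 2) (V := Additive A)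
    rw [ZMod.card, ← Nat.card_eq_fintype_card] at h
    have h' : Nat.card (Additive A) = 2 ^ e := he
    rw [h'] at h
    exact (Nat.pow_right_injective le_rfl h).symm
  let φ : Additive A ≃ₗ[ZMod 2] (Fin e → ZMod 2) := (Module.finBasisOfFinrankEq _ _ hfin).equivFun
  let lin : (Additive A ≃+ Additive A) ≃ (Additive A ≃ₗ[ZMod 2] Additive A) :=
    { toFun := fun f => { f with map_smul' := ZMod.map_smul f }
      invFun := fun f => f.toAddEquiv
      left_inv := fun _ => rfl
      right_inv := fun _ => rfl }
  have hcard : Nat.card (MulAut A) = Nat.card (GL (Fin e) (ZMod 2)) :=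
    Nat.card_congr (MulEquiv.toAdditive.trans (lin.trans
      ((LinearMap.GeneralLinearGroup.generalLinearEquiv (ZMod 2) (Additive A)).symm.toEquiv.trans
        ((LinearMap.GeneralLinearGroup.congrLinearEquiv φ).toEquiv.trans
          Matrix.GeneralLinearGroup.toLin.symm.toEquiv))))
  rw [hcard, Matrix.card_GL_field, ZMod.card]

theorem IsPGroup.index_centralizer_le {G : Type*} [Group G] [Finite G] (hG : IsPGroup 2 G)
    {E : Subgroup G} [E.Normal] (hE : IsElementaryAbelian 2 E) {e : ℕ} (he : Nat.card E = 2 ^ e) :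
    (Subgroup.centralizer (E : Set G)).index ≤ 2 ^ (e * (e - 1) / 2) := by
  let ψ : G →* MulAut E := MulAut.conjNormal
  have hker : ψ.ker ≤ Subgroup.centralizer (E : Set G) := fun x hx =>
    Subgroup.mem_centralizer_iff.2 fun b hb => by
      have := congrArg Subtype.val (DFunLike.congr_fun (MonoidHom.mem_ker.1 hx) (⟨b, hb⟩ : E))
      rw [MulAut.conjNormal_apply, MulAut.one_apply, mul_inv_eq_iff_eq_mul] at this
      exact this.symm
  refine (Nat.le_of_dvd (Nat.pos_of_ne_zero Subgroup.FiniteIndex.index_ne_zero)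
    (Subgroup.index_dvd_of_le hker)).trans ?_
  obtain ⟨j, hj⟩ := hG.index ψ.ker
  rw [hj]
  refine Nat.pow_le_pow_right two_pos (Nat.le_of_two_pow_dvd_prod_two_pow_sub ?_)
  rw [← hE.card_mulAut he, ← hj, Subgroup.index_ker]
  exact Subgroup.card_subgroup_dvd_card _

/-! ### The bound -/

theorem mainTheorem6 {G : Type*} [Group G] [Finite G] (hG : IsPGroup 2 G)
    (E : Subgroup G) (hE : IsMaximalNormalElementaryAbelian 2 E)
    (k : ℕ) (hk : Group.rank E = k) :
    (agemo 2 1 G).index ≤ 2 ^ (k * (k + 5) / 2) := by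
  have hEn : E.Normal := hE.prop.1
  obtain ⟨e, he⟩ := IsPGroup.iff_card.1 (hG.to_subgroup E)
  have hek : e ≤ k := by
    have h := hE.prop.2.card_le_two_pow_rank
    rw [hk, he] at h
    exact (Nat.pow_le_pow_iff_right (by norm_num : 1 < 2)).1 h
  set C := Subgroup.centralizer (E : Set G) with hC
  have h1 : C.index ≤ 2 ^ (e * (e - 1) / 2) := hG.index_centralizer_le hE.prop.2 he
  -- Otherwise the counting theorem with `m = e` makes `2 ^ (e+1) = 2|E|` divide the number of
  -- solutions.
  have h2 : Nat.card C ≤ 2 ^ (3 * e) * Nat.card (agemo 2 1 G) := by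
    by_contra! hlt
    refine hE.not_two_mul_card_dvd hG ?_
    rw [he, ← pow_succ']
    refine hG.two_pow_dvd_card_sq_eq_one (Y := agemo 2 1 G ⊓ C) inf_le_right ?_
      ((Nat.mul_le_mul_left _ (Subgroup.card_le_of_le inf_le_left)).trans_lt hlt)
    intro c hc
    refine ⟨Subgroup.subset_closure ⟨c, ?_⟩, mul_mem hc hc⟩
    simp [pow_two]
  have h3 : e * (e - 1) / 2 + 3 * e ≤ k * (k + 5) / 2 := by
    have h4 : e * (e - 1) / 2 + 3 * e = e * (e + 5) / 2 := by
      rcases e with _ | e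
      · rfl
      · rw [Nat.add_sub_cancel, ← Nat.add_mul_div_left _ _ two_pos]
        congr 1
        ring
    rw [h4]
    exact Nat.div_le_div_right (Nat.mul_le_mul hek (by omega))
  refine le_trans ?_ (Nat.pow_le_pow_right two_pos h3)
  refine Nat.le_of_mul_le_mul_left ?_ (Nat.card_pos (α := agemo 2 1 G))
  rw [Subgroup.card_mul_index, ← C.card_mul_index, pow_add]
  calc _ ≤ (2 ^ (3 * e) * Nat.card (agemo 2 1 G)) * 2 ^ (e * (e - 1) / 2) := Nat.mul_le_mul h2 h1
    _ = _ := by ring
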